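/- Let $(\Sigma,\mathcal B,\mu)$ be a $\sigma$-finite measure space and let $M(\Sigma,\mu)$ be the space of $\mu$-a.e. equivalence classes of measurable functions $u:\Sigma\to\mathbb R$. Let $J_0$ be the set of all convex, lower semicontinuous $j:\mathbb R\to[0,+\infty]$ with $j(0)=0$, and for $u,v\in M(\Sigma,\mu)$ write $u\ll v$ if $\int_\Sigma j(u)\,d\mu\le\int_\Sigma j(v)\,d\mu$ for all $j\in J_0$. Put $$L_0(\Sigma,\mu)=\Big\{u\in M(\Sigma,\mu)\;\Big|\;\int_\Sigma\big[|u|-k\big]^+\,d\mu<\infty\text{ for all }k>0\Big\},\qquad L^{1\cap\infty}(\Sigma,\mu)=L^1(\Sigma,\mu)\cap L^\infty(\Sigma,\mu).$$ A sequence $(u_n)$ in $L_0(\Sigma,\mu)$ converges $\sigma(L_0,L^{1\cap\infty})$-weakly to $u\in L_0(\Sigma,\mu)$ if $\int_\Sigma v\,u_n\,d\mu\to\int_\Sigma v\,u\,d\mu$ for every $v\in L^{1\cap\infty}(\Sigma,\mu)$. A subset $K\subseteq L_0(\Sigma,\mu)$ is called $\sigma(L_0,L^{1\cap\infty})$-weakly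 sequentially compact in $L_0(\Sigma,\mu)$ if every sequence in $K$ has a subsequence that converges $\sigma(L_0,L^{1\cap\infty})$-weakly to some element of $L_0(\Sigma,\mu)$ (not necessarily in $K$). Let $X\subseteq L_0(\Sigma,\mu)$ be a Banach space with norm $\|\cdot\|_X$ that is normal, i.e. for every $u\in X$ and $v\in M(\Sigma,\mu)$ with $v\ll u$ one has $v\in X$ and $\|v\|_X\le\|u\|_X$. Suppose also that for every $u\in X$ and every sequence $(u_n)_{n\ge1}$ in $M(\Sigma,\mu)$ with $u_n\ll u$ for all $n$ and $u_n\to u$ $\mu$-a.e. on $\Sigma$, one has $u_n\to u$ in $X$. Let $\omega\in\mathbb R$, $\alpha\in\mathbb R\setminus\{1\}$, let $C\subseteq X$ be a subset with $0\in C$ and $\lambda^{\frac1{\alpha-1}}u\in C$ for all $u\in C$ and $\lambda>0$, and let $\{T_t\}_{t\ge0}$ be a family of mappings $T_t:C\to C$ such that 1. each $T_t$ is $\omega$-quasi completely contractive, i.e. there is an $s=s(t)\ge0$ (for instance $s(t)=t$) with $e^{-\omega s}T_tu-e^{-\omega s}T_t\hat u\ll u-\hat u$ for all $u,\hat u\in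 C$; 2. $\lambda^{\frac1{\alpha-1}}\,T_{\lambda t}u=T_t\big[\lambda^{\frac1{\alpha-1}}u\big]$ for all $\lambda>0$, $t\ge0$ and $u\in C$; 3. $T_t0=0$ for all $t\ge0$. Then, for every $u_0\in C$ and $t>0$, the set $$\Big\{\frac{T_{t+h}u_0-T_tu_0}{h}\;\Big|\;h\neq0,\ t+h>0\Big\}$$ is $\sigma(L_0,L^{1\cap\infty})$-weakly sequentially compact in $L_0(\Sigma,\mu)$. -/

import Mathlib

open MeasureTheory Filter Topology Set
open scoped NNReal ENNReal

/-- The class `J₀` of all convex, lower semicontinuous `j : ℝ → [0, ∞]` with `j 0 = 0`.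
(Convexity only involves nonnegative weights, hence the scalars `ℝ≥0`, which act on `[0, ∞]`
with the convention `0 • ∞ = 0`.) -/
def J₀ : Set (ℝ → ℝ≥0∞) :=
  {j | ConvexOn ℝ≥0 univ j ∧ LowerSemicontinuous j ∧ j 0 = 0}

/-- The relation `u ≪ v` on the space `M(S, μ)` of a.e.-classes of measurable functions:
`∫ j(u) dμ ≤ ∫ j(v) dμ` for all `j ∈ J₀`. -/
def CDom {S : Type*} [MeasurableSpace S] {μ : Measure S} (u v : S →ₘ[μ] ℝ) : Prop :=
  ∀ j ∈ J₀, ∫⁻ x, j (u x) ∂μ ≤ ∫⁻ x, j (v x) ∂μ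

/-- The map `F`, defined on `D ⊆ M(S, μ)`, is an `L`-complete contraction. -/
def IsCompleteContractionOn {S : Type*} [MeasurableSpace S] {μ : Measure S}
    (L : ℝ) (F : (S →ₘ[μ] ℝ) → (S →ₘ[μ] ℝ)) (D : Set (S →ₘ[μ] ℝ)) : Prop :=
  ∀ u ∈ D, ∀ v ∈ D, CDom (L⁻¹ • F u - L⁻¹ • F v) (u - v)

/-- The map `F`, defined on `D ⊆ M(S, μ)`, is `ω`-quasi completely contractive: it is an
`L`-complete contraction with `L = exp (ω s)` for some `s ≥ 0`. -/
def IsQuasiCompleteContractionOn {S : Type*} [MeasurableSpace S] {μ : Measure S}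
    (ω : ℝ) (F : (S →ₘ[μ] ℝ) → (S →ₘ[μ] ℝ)) (D : Set (S →ₘ[μ] ℝ)) : Prop :=
  ∃ s : ℝ, 0 ≤ s ∧ IsCompleteContractionOn (Real.exp (ω * s)) F D

/-- The space `L₀(S, μ)` of all `u ∈ M(S, μ)` with `∫ [|u| - k]⁺ dμ < ∞` for all `k > 0`. -/
def L₀ {S : Type*} [MeasurableSpace S] (μ : Measure S) : Set (S →ₘ[μ] ℝ) :=
  {u | ∀ k : ℝ, 0 < k → ∫⁻ x, ENNReal.ofReal (max (|u x| - k) 0) ∂μ < ∞}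

/-- The space `L¹(S, μ) ∩ L^∞(S, μ)`. -/
def L1capLinfty {S : Type*} [MeasurableSpace S] (μ : Measure S) : Set (S →ₘ[μ] ℝ) :=
  {v | MemLp v 1 μ ∧ MemLp v ∞ μ}

/-- The pairing `∫ v u dμ` of `v ∈ L¹ ∩ L^∞` with `u ∈ L₀` is an absolutely convergent integral. -/
theorem integrable_mul_of_mem_L₀ {S : Type*} [MeasurableSpace S] {μ : Measure S}
    {u v : S →ₘ[μ] ℝ} (hu : u ∈ L₀ μ) (hv : v ∈ L1capLinfty μ) :
    Integrable (fun x => v x * u x) μ := by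
  have hi : Integrable (fun x => max (|u x| - 1) 0) μ := by
    refine ⟨((continuous_abs.sub continuous_const).max continuous_const).comp_aestronglyMeasurable
      u.aestronglyMeasurable, ?_⟩
    have h0 : ∀ᵐ x ∂μ, (0 : ℝ) ≤ max (|u x| - 1) 0 := Eventually.of_forall fun x => le_max_right _ _
    exact (hasFiniteIntegral_iff_ofReal h0).2 (hu 1 one_pos)
  have h1 : Integrable (fun x => v x * max (|u x| - 1) 0) μ :=
    Integrable.mul_of_top_right hi hv.2
  have h2 : Integrable (fun x => |v x * max (|u x| - 1) 0| + |v x|) μ :=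
    h1.abs.add (memLp_one_iff_integrable.1 hv.1).abs
  refine h2.mono' (v.aestronglyMeasurable.mul u.aestronglyMeasurable) (Eventually.of_forall ?_)
  intro x
  have h3 : |u x| ≤ max (|u x| - 1) 0 + 1 := by linarith [le_max_left (|u x| - 1) 0]
  rw [Real.norm_eq_abs, abs_mul, abs_mul, abs_of_nonneg (le_max_right (|u x| - 1) 0)]
  nlinarith [mul_le_mul_of_nonneg_left h3 (abs_nonneg (v x))]

/-- `σ(L₀, L¹ ∩ L^∞)`-weak convergence of a sequence `u` to `z`. -/
def WeakTendstoL₀ {S : Type*} [MeasurableSpace S] {μ : Measure S}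
    (u : ℕ → S →ₘ[μ] ℝ) (z : S →ₘ[μ] ℝ) : Prop :=
  ∀ v ∈ L1capLinfty μ, Tendsto (fun n => ∫ x, v x * u n x ∂μ) atTop (𝓝 (∫ x, v x * z x ∂μ))

/-- The set `K` is `σ(L₀, L¹ ∩ L^∞)`-weakly sequentially compact in `L₀(S, μ)`: it is contained
in `L₀` and every sequence in `K` has a subsequence which converges weakly to an element
of `L₀`. -/
def IsWeaklySeqCompactInL₀ {S : Type*} [MeasurableSpace S] {μ : Measure S}
    (K : Set (S →ₘ[μ] ℝ)) : Prop :=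
  K ⊆ L₀ μ ∧ ∀ q : ℕ → S →ₘ[μ] ℝ, (∀ n, q n ∈ K) →
    ∃ z ∈ L₀ μ, ∃ φ : ℕ → ℕ, StrictMono φ ∧ WeakTendstoL₀ (q ∘ φ) z

/-- A Banach space `X ⊆ M(S, μ)`: a linear subspace with a complete norm. -/
structure BanachSubspace {S : Type*} [MeasurableSpace S] (μ : Measure S) where
  /-- the underlying linear subspace -/
  space : Submodule ℝ (S →ₘ[μ] ℝ)
  /-- the norm -/
  norm : Seminorm ℝ space
  eq_zero_of_norm_eq_zero : ∀ u : space, norm u = 0 → u = 0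
  complete : ∀ u : ℕ → space,
    (∀ ε : ℝ, 0 < ε → ∃ N : ℕ, ∀ m ≥ N, ∀ n ≥ N, norm (u m - u n) < ε) →
    ∃ z : space, Tendsto (fun n => norm (u n - z)) atTop (𝓝 0)

/-- `X` is normal: if `u ∈ X` and `v ≪ u`, then `v ∈ X` and `‖v‖ ≤ ‖u‖`. -/
def BanachSubspace.IsNormal {S : Type*} [MeasurableSpace S] {μ : Measure S}
    (X : BanachSubspace μ) : Prop :=
  ∀ (u : X.space) (v : S →ₘ[μ] ℝ), CDom v u → ∃ hv : v ∈ X.space, X.norm ⟨v, hv⟩ ≤ X.norm u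

/-- If `u ∈ X`, `w n ≪ u` for all `n` and `w n → u` a.e., then `w n → u` in `X`. -/
def BanachSubspace.DominatedConvergence {S : Type*} [MeasurableSpace S] {μ : Measure S}
    (X : BanachSubspace μ) : Prop :=
  ∀ (u : X.space) (w : ℕ → S →ₘ[μ] ℝ), (∀ n, CDom (w n) u) →
    (∀ᵐ x ∂μ, Tendsto (fun n => w n x) atTop (𝓝 ((u : S →ₘ[μ] ℝ) x))) →
    ∃ hw : ∀ n, w n ∈ X.space, Tendsto (fun n => X.norm (⟨w n, hw n⟩ - u)) atTop (𝓝 0)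

/-! Put `P = ((t + h) / t) ^ β` with `β = 1 / (α - 1)`. Homogeneity trades the change of time for a
change of initial value, `T (t + h) u₀ = P⁻¹ • T t (P • u₀)`, so for `P ≠ 1` the increment `T (t +
h) u₀ - T t u₀` equals `(1 - P⁻¹) • ((P - 1)⁻¹ • (T t (P • u₀) - T t u₀) - T t u₀)`. With `L = exp
(ω s)`, contractivity of `T t` and `T t 0 = 0` bound the excesses `∫ [|·| - k]⁺` of both terms in
the bracket, divided by `L`, by those of `u₀`. For small `h` the factor `1 - P⁻¹` is `O(h)`; for
large `h` the bound on `1 / h` suffices.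

Hence all difference quotients have excesses below one function `G` with `G k → 0` as `k → ∞`, and
`exists_weakTendstoL₀_of_excess_le` yields compactness: truncations at positive rational levels
converge weakly-* in `L^∞` along one subsequence, and their limits are Cauchy in the `L¹` distance
because the truncation error at level `k` is at most `G k`. -/

/-! ### Weak sequential compactness in Hilbert spaces. -/

/-- If `⟪x n, h⟫` has a limit for all `h` in a set `s`, then it has one for all `h` in the closed
span of `s`, provided `x` is bounded. -/
theorem exists_tendsto_inner_of_mem_closure_span {H : Type*} [NormedAddCommGroup H]
    [InnerProductSpace ℝ H] {x : ℕ → H} {c : ℝ} (hx : ∀ n, ‖x n‖ ≤ c) {s : Set H}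
    (hs : ∀ h ∈ s, ∃ l : ℝ, Tendsto (fun n => inner ℝ (x n) h) atTop (𝓝 l)) {h : H}
    (hh : h ∈ (Submodule.span ℝ s).topologicalClosure) :
    ∃ l : ℝ, Tendsto (fun n => inner ℝ (x n) h) atTop (𝓝 l) := by
  have hc : 0 ≤ c := (norm_nonneg _).trans (hx 0)
  have h1 : ∀ h ∈ Submodule.span ℝ s,
      ∃ l : ℝ, Tendsto (fun n => inner ℝ (x n) h) atTop (𝓝 l) := by
    intro h hh
    induction hh using Submodule.span_induction with
    | mem h hh => exact hs h hh
    | zero => exact ⟨0, by simp⟩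
    | add a b _ _ ha hb =>
      obtain ⟨l, hl⟩ := ha
      obtain ⟨m, hm⟩ := hb
      exact ⟨l + m, by simpa only [inner_add_right] using hl.add hm⟩
    | smul r a _ ha =>
      obtain ⟨l, hl⟩ := ha
      exact ⟨r * l, by simpa only [real_inner_smul_right] using hl.const_mul r⟩
  apply cauchySeq_tendsto_of_complete
  rw [Metric.cauchySeq_iff']
  intro ε hε
  have hδ : 0 < ε / (4 * (c + 1)) := by positivity
  obtain ⟨p, hp, hpd⟩ := Metric.mem_closure_iff.1
    (show h ∈ closure (Submodule.span ℝ s : Set H) from hh) _ hδ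
  obtain ⟨l, hl⟩ := h1 p hp
  obtain ⟨N, hN⟩ := Metric.cauchySeq_iff'.1 hl.cauchySeq (ε / 2) (half_pos hε)
  refine ⟨N, fun n hn => ?_⟩
  have h2 : ∀ m, |inner ℝ (x m) h - inner ℝ (x m) p| ≤ ε / 4 := by
    intro m
    rw [← inner_sub_right]
    refine (abs_real_inner_le_norm _ _).trans ?_
    rw [dist_eq_norm] at hpd
    calc ‖x m‖ * ‖h - p‖ ≤ (c + 1) * (ε / (4 * (c + 1))) := by
          gcongr
          linarith [hx m]
      _ = ε / 4 := by field_simp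
  have h3 := hN n hn
  have h4 := abs_le.1 (h2 n)
  have h5 := abs_le.1 (h2 N)
  rw [Real.dist_eq, abs_lt] at h3 ⊢
  constructor <;> linarith [h3.1, h3.2, h4.1, h4.2, h5.1, h5.2]

/-- Countably many bounded sequences in a Hilbert space have a common subsequence of indices along
which all of them converge weakly. -/
theorem exists_strictMono_forall_tendsto_inner {H : Type*} [NormedAddCommGroup H]
    [InnerProductSpace ℝ H] [CompleteSpace H] {ι : Type*} [Countable ι] (x : ι → ℕ → H)
    (c : ι → ℝ) (hx : ∀ i n, ‖x i n‖ ≤ c i) :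
    ∃ φ : ℕ → ℕ, StrictMono φ ∧ ∀ i, ∃ y : H, ∀ h : H,
      Tendsto (fun n => inner ℝ (x i (φ n)) h) atTop (𝓝 (inner ℝ y h)) := by
  -- Only the countably many inner products among the given vectors are made to converge. They lie
  -- in a countable product of compact intervals, which replaces a diagonal argument; `H` need not
  -- be separable.
  let a : ℕ → (ι × ι × ℕ → ℝ) := fun n p => inner ℝ (x p.1 n) (x p.2.1 p.2.2)
  have hK : IsCompact (univ.pi fun p : ι × ι × ℕ => Icc (-(c p.1 * c p.2.1)) (c p.1 * c p.2.1)) :=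
    isCompact_univ_pi fun _ => isCompact_Icc
  have ha : ∀ n, a n ∈ univ.pi fun p : ι × ι × ℕ =>
      Icc (-(c p.1 * c p.2.1)) (c p.1 * c p.2.1) := by
    intro n p _
    refine abs_le.1 ((abs_real_inner_le_norm _ _).trans ?_)
    exact mul_le_mul (hx _ _) (hx _ _) (norm_nonneg _) ((norm_nonneg _).trans (hx p.1 n))
  obtain ⟨l, -, φ, hφ, hl⟩ := hK.isSeqCompact ha
  refine ⟨φ, hφ, fun i => ?_⟩
  let s : Set H := range fun p : ι × ℕ => x p.1 p.2
  let E := (Submodule.span ℝ s).topologicalClosure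
  have hE : CompleteSpace E := (Submodule.isClosed_topologicalClosure _).completeSpace_coe
  have hsE : ∀ n, x i n ∈ E := fun n =>
    Submodule.le_topologicalClosure _ (Submodule.subset_span ⟨(i, n), rfl⟩)
  have hs : ∀ h ∈ s, ∃ l : ℝ, Tendsto (fun n => inner ℝ (x i (φ n)) h) atTop (𝓝 l) := by
    rintro _ ⟨p, rfl⟩
    exact ⟨l (i, p.1, p.2), (tendsto_pi_nhds.1 hl) (i, p.1, p.2)⟩
  -- The component of `h` orthogonal to `E` pairs to zero with every `x i n`, so only its projection
  -- matters.
  have hlim : ∀ h : H, ∃ l : ℝ, Tendsto (fun n => inner ℝ (x i (φ n)) h) atTop (𝓝 l) := by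
    intro h
    obtain ⟨m, hm⟩ := exists_tendsto_inner_of_mem_closure_span (fun n => hx i (φ n)) hs
      (E.starProjection_apply_mem h)
    refine ⟨m, hm.congr fun n => ?_⟩
    have := E.starProjection_inner_eq_zero h (x i (φ n)) (hsE _)
    rw [real_inner_comm, inner_sub_right] at this
    linarith
  choose f hf using hlim
  -- The pointwise limit is a bounded functional by Banach–Steinhaus; Riesz representation gives
  -- `y`.
  let F : H →L[ℝ] ℝ := continuousLinearMapOfTendsto (fun n => innerSL ℝ (x i (φ n)))
    (f := f) (tendsto_pi_nhds.2 hf)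
  refine ⟨(InnerProductSpace.toDual ℝ H).symm F, fun h => ?_⟩
  rw [InnerProductSpace.toDual_symm_apply]
  exact hf h

/-- Convergence of a sequence which is approximated by convergent ones uniformly. -/
theorem tendsto_of_forall_abs_sub_le {A : ℕ → ℝ} {B : ℝ} {a : ℕ → ℕ → ℝ} {b e : ℕ → ℝ}
    (ha : ∀ m, Tendsto (a m) atTop (𝓝 (b m))) (hA : ∀ m n, |A n - a m n| ≤ e m)
    (hB : ∀ m, |B - b m| ≤ e m) (he : Tendsto e atTop (𝓝 0)) : Tendsto A atTop (𝓝 B) := by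
  rw [Metric.tendsto_atTop]
  intro ε hε
  obtain ⟨m, hm⟩ := (he.eventually (gt_mem_nhds (show (0 : ℝ) < ε / 3 by positivity))).exists
  obtain ⟨N, hN⟩ := Metric.tendsto_atTop.1 (ha m) (ε / 3) (by positivity)
  refine ⟨N, fun n hn => ?_⟩
  have h1 := hN n hn
  have h2 := abs_le.1 (hA m n)
  have h3 := abs_le.1 (hB m)
  rw [Real.dist_eq, abs_lt] at h1 ⊢
  constructor <;> linarith [h1.1, h1.2, h2.1, h2.2, h3.1, h3.2]

/-! ### Weak-* sequential compactness in `L^∞` over a σ-finite measure. -/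

section

variable {S : Type*} [MeasurableSpace S] {μ : Measure S}

theorem inner_toLp_toLp {a b : S → ℝ} (ha : MemLp a 2 μ) (hb : MemLp b 2 μ) :
    inner ℝ (ha.toLp a) (hb.toLp b) = ∫ x, a x * b x ∂μ := by
  rw [L2.inner_def]
  refine integral_congr_ae ?_
  filter_upwards [ha.coeFn_toLp, hb.coeFn_toLp] with x h1 h2
  rw [h1, h2, real_inner_eq_re_inner]
  simp [mul_comm]

theorem MeasureTheory.Integrable.mul_of_ae_abs_le {v f : S → ℝ} {c : ℝ} (hv : Integrable v μ)
    (hf : AEStronglyMeasurable f μ) (hfc : ∀ᵐ x ∂μ, |f x| ≤ c) :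
    Integrable (fun x => v x * f x) μ :=
  hv.mul_bdd (c := c) hf hfc

theorem abs_integral_mul_sub_integral_mul_le {v w f : S → ℝ} {c : ℝ} (hv : Integrable v μ)
    (hw : Integrable w μ) (hf : AEStronglyMeasurable f μ) (hfc : ∀ᵐ x ∂μ, |f x| ≤ c) :
    |∫ x, v x * f x ∂μ - ∫ x, w x * f x ∂μ| ≤ c * ∫ x, |v x - w x| ∂μ := by
  rw [← integral_sub (hv.mul_of_ae_abs_le hf hfc) (hw.mul_of_ae_abs_le hf hfc),
    ← integral_const_mul, ← Real.norm_eq_abs]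
  refine norm_integral_le_of_norm_le ((hv.sub hw).abs.const_mul c) ?_
  filter_upwards [hfc] with x hx
  rw [← sub_mul, norm_mul, mul_comm]
  exact mul_le_mul_of_nonneg_right hx (abs_nonneg _)

/-- The square root of a strictly positive integrable function. As a weight it carries bounded
functions into `L²`, where the Hilbert space argument applies. -/
theorem exists_pos_memLp_two (μ : Measure S) [SigmaFinite μ] :
    ∃ ρ : S → ℝ, (∀ x, 0 < ρ x) ∧ Measurable ρ ∧ MemLp ρ 2 μ := by
  obtain ⟨g, hg0, hgm, hgi⟩ := exists_pos_lintegral_lt_of_sigmaFinite μ one_ne_zero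
  have hm : Measurable fun x => Real.sqrt (g x) := hgm.coe_nnreal_real.sqrt
  refine ⟨fun x => Real.sqrt (g x), fun x => Real.sqrt_pos.2 (hg0 x), hm, ?_⟩
  rw [memLp_two_iff_integrable_sq hm.aestronglyMeasurable]
  have : (fun x => Real.sqrt (g x) ^ 2) = fun x => (g x : ℝ) := by
    ext x
    exact Real.sq_sqrt (g x).2
  rw [this]
  refine ⟨hgm.coe_nnreal_real.aestronglyMeasurable, ?_⟩
  refine (hasFiniteIntegral_iff_ofReal (Eventually.of_forall fun x => (g x).2)).2 ?_
  simpa using hgi.trans ENNReal.one_lt_top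

/-- Density in `L¹` of the products `ρ h` with `h ∈ L²`. -/
theorem exists_seq_memLp_two_tendsto {ρ v : S → ℝ} (hρ0 : ∀ x, 0 < ρ x) (hρm : Measurable ρ)
    (hρ : MemLp ρ 2 μ) (hv : Integrable v μ) :
    ∃ h : ℕ → S → ℝ, (∀ m, MemLp (h m) 2 μ) ∧
      Tendsto (fun m => ∫ x, |v x - ρ x * h m x| ∂μ) atTop (𝓝 0) := by
  obtain ⟨w, hwm, hvw⟩ := hv.1
  have hwm' := hwm.measurable
  have hA : ∀ m : ℕ, MeasurableSet {x | |w x| ≤ m * ρ x ^ 2} := fun m =>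
    measurableSet_le hwm'.abs ((hρm.pow_const 2).const_mul _)
  have hmeas : ∀ m : ℕ, Measurable
      ({x | |w x| ≤ m * ρ x ^ 2}.indicator fun x => w x / ρ x) := fun m =>
    (hwm'.div hρm).indicator (hA m)
  -- On this set `|w / ρ| ≤ m ρ`, hence the cut-off quotient is in `L²`; since `ρ > 0`, the sets
  -- exhaust the space.
  refine ⟨fun m => {x | |w x| ≤ m * ρ x ^ 2}.indicator fun x => w x / ρ x, fun m => ?_, ?_⟩
  · refine hρ.of_le_mul (c := m) (hmeas m).aestronglyMeasurable (Eventually.of_forall fun x => ?_)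
    rw [Real.norm_of_nonneg (hρ0 x).le]
    beta_reduce
    by_cases hx : x ∈ {x | |w x| ≤ m * ρ x ^ 2}
    · rw [indicator_of_mem hx, norm_div, Real.norm_of_nonneg (hρ0 x).le, div_le_iff₀ (hρ0 x)]
      calc ‖w x‖ ≤ m * ρ x ^ 2 := hx
        _ = _ := by ring
    · rw [indicator_of_notMem hx, norm_zero]
      have := hρ0 x
      positivity
  · rw [← integral_zero S ℝ (μ := μ)]
    refine tendsto_integral_of_dominated_convergence (fun x => |v x|)
      (fun m => (hv.1.sub (hρm.mul (hmeas m)).aestronglyMeasurable).norm) hv.abs ?_ ?_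
    · intro m
      filter_upwards [hvw] with x hx
      rw [Real.norm_eq_abs, abs_abs]
      by_cases hxm : x ∈ {x | |w x| ≤ m * ρ x ^ 2}
      · rw [indicator_of_mem hxm, mul_div_cancel₀ _ (hρ0 x).ne', hx]
        simp
      · rw [indicator_of_notMem hxm]
        simp
    · filter_upwards [hvw] with x hx
      refine tendsto_const_nhds.congr' ?_
      obtain ⟨N, hN⟩ := exists_nat_ge (|w x| / ρ x ^ 2)
      filter_upwards [eventually_ge_atTop N] with m hm
      have hxm : x ∈ {x | |w x| ≤ m * ρ x ^ 2} := by
        have h2 : 0 < ρ x ^ 2 := pow_pos (hρ0 x) 2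
        rw [mem_ofPred_eq, ← div_le_iff₀ h2]
        exact hN.trans (by exact_mod_cast hm)
      rw [indicator_of_mem hxm, mul_div_cancel₀ _ (hρ0 x).ne', hx]
      simp

/-- Bounds pass to weak limits. -/
theorem ae_le_mul_of_forall_tendsto {ρ y : S → ℝ} {f : ℕ → S → ℝ} {c : ℝ}
    (hρ0 : ∀ x, 0 < ρ x) (hρ : MemLp ρ 2 μ) (hy : MemLp y 2 μ)
    (hfm : ∀ n, AEStronglyMeasurable (f n) μ) (hf : ∀ n, ∀ᵐ x ∂μ, |f n x| ≤ c)
    (hfy : ∀ h, MemLp h 2 μ →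
      Tendsto (fun n => ∫ x, ρ x * f n x * h x ∂μ) atTop (𝓝 (∫ x, y x * h x ∂μ))) :
    ∀ᵐ x ∂μ, y x ≤ c * ρ x := by
  -- The extra factor `ρ` makes both sides integrable, so they can be compared on sets by testing
  -- with `s.indicator ρ`.
  have h1 : (fun x => y x * ρ x) ≤ᵐ[μ] fun x => c * ρ x * ρ x := by
    have hi : Integrable (fun x => c * ρ x * ρ x) μ := (hρ.const_mul c).integrable_mul hρ
    refine ae_le_of_forall_setIntegral_le (hy.integrable_mul hρ) hi fun s hs _ => ?_
    have h2 := hfy (s.indicator ρ) (hρ.indicator hs)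
    have h3 : ∀ a : S → ℝ, ∫ x, a x * s.indicator ρ x ∂μ = ∫ x in s, a x * ρ x ∂μ := by
      intro a
      rw [← integral_indicator hs]
      congr 1
      ext x
      by_cases hx : x ∈ s <;> simp [hx]
    simp only [h3] at h2
    refine le_of_tendsto h2 (Eventually.of_forall fun n => ?_)
    have hfn : MemLp (fun x => ρ x * f n x) 2 μ := by
      refine hρ.of_le_mul (c := c) (hρ.1.mul (hfm n)) ?_
      filter_upwards [hf n] with x hx
      rw [norm_mul, mul_comm]
      exact mul_le_mul_of_nonneg_right hx (norm_nonneg _)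
    refine integral_mono_ae (hfn.integrable_mul hρ).integrableOn hi.integrableOn
      (ae_restrict_of_ae ?_)
    filter_upwards [hf n] with x hx
    have h4 := (abs_le.1 hx).2
    have h5 := hρ0 x
    calc ρ x * f n x * ρ x = f n x * (ρ x * ρ x) := by ring
      _ ≤ c * (ρ x * ρ x) := by gcongr
      _ = _ := by ring
  filter_upwards [h1] with x hx
  exact le_of_mul_le_mul_right hx (hρ0 x)

/-- Countably many bounded sequences in `L^∞` have a common subsequence of indices along
which all of them converge weakly-* (tested against `L¹`). -/
theorem exists_strictMono_forall_tendsto_integral_mul [SigmaFinite μ] {ι : Type*} [Countable ι]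
    (f : ι → ℕ → S → ℝ) (c : ι → ℝ) (hfm : ∀ i n, AEStronglyMeasurable (f i n) μ)
    (hf : ∀ i n, ∀ᵐ x ∂μ, |f i n x| ≤ c i) :
    ∃ φ : ℕ → ℕ, StrictMono φ ∧ ∀ i, ∃ z : S → ℝ, AEStronglyMeasurable z μ ∧
      (∀ᵐ x ∂μ, |z x| ≤ c i) ∧ ∀ v, Integrable v μ →
        Tendsto (fun n => ∫ x, v x * f i (φ n) x ∂μ) atTop (𝓝 (∫ x, v x * z x ∂μ)) := by
  obtain ⟨ρ, hρ0, hρm, hρ⟩ := exists_pos_memLp_two μ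
  have hle : ∀ i n, ∀ᵐ x ∂μ, ‖ρ x * f i n x‖ ≤ c i * ‖ρ x‖ := by
    intro i n
    filter_upwards [hf i n] with x hx
    rw [norm_mul, mul_comm]
    exact mul_le_mul_of_nonneg_right hx (norm_nonneg _)
  have hfL : ∀ i n, MemLp (fun x => ρ x * f i n x) 2 μ := fun i n =>
    hρ.of_le_mul (hρ.1.mul (hfm i n)) (hle i n)
  obtain ⟨φ, hφ, hy⟩ := exists_strictMono_forall_tendsto_inner
    (fun i n => (hfL i n).toLp _) (fun i => c i * ‖hρ.toLp ρ‖) (by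
      intro i n
      refine Lp.norm_le_mul_norm_of_ae_le_mul ?_
      filter_upwards [hle i n, (hfL i n).coeFn_toLp, hρ.coeFn_toLp] with x h1 h2 h3
      rw [h2, h3]
      exact h1)
  refine ⟨φ, hφ, fun i => ?_⟩
  obtain ⟨y, hy⟩ := hy i
  have hyL : MemLp y 2 μ := Lp.memLp y
  have hfy : ∀ h, MemLp h 2 μ →
      Tendsto (fun n => ∫ x, ρ x * f i (φ n) x * h x ∂μ) atTop (𝓝 (∫ x, y x * h x ∂μ)) := by
    intro h hh
    have h1 := hy (hh.toLp h)
    rw [← Lp.toLp_coeFn y hyL] at h1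
    simpa only [inner_toLp_toLp] using h1
  have hu := ae_le_mul_of_forall_tendsto hρ0 hρ hyL (fun n => hfm i (φ n)) (fun n => hf i (φ n)) hfy
  have hl := ae_le_mul_of_forall_tendsto (y := fun x => -y x) (f := fun n x => -f i (φ n) x)
    hρ0 hρ hyL.neg (fun n => (hfm i (φ n)).neg)
    (fun n => by simpa only [abs_neg] using hf i (φ n)) (fun h hh => by
      simpa only [mul_neg, neg_mul, integral_neg] using (hfy h hh).neg)
  have hzm : AEStronglyMeasurable (fun x => y x / ρ x) μ :=
    (hyL.1.aemeasurable.div hρm.aemeasurable).aestronglyMeasurable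
  have hzc : ∀ᵐ x ∂μ, |y x / ρ x| ≤ c i := by
    filter_upwards [hu, hl] with x h1 h2
    rw [abs_div, abs_of_pos (hρ0 x), div_le_iff₀ (hρ0 x), abs_le]
    constructor <;> linarith
  -- If `ρ f` tends weakly in `L²` to `y`, the limit of `f` must be `y / ρ`. Test functions `ρ h`
  -- with `h ∈ L²` are immediate, and the uniform `L^∞` bound extends this to all of `L¹` by
  -- density.
  refine ⟨fun x => y x / ρ x, hzm, hzc, fun v hv => ?_⟩
  obtain ⟨h, hh, hvh⟩ := exists_seq_memLp_two_tendsto hρ0 hρm hρ hv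
  have hρh : ∀ m, Integrable (fun x => ρ x * h m x) μ := fun m => hρ.integrable_mul (hh m)
  refine tendsto_of_forall_abs_sub_le (a := fun m n => ∫ x, ρ x * h m x * f i (φ n) x ∂μ)
    (b := fun m => ∫ x, ρ x * h m x * (y x / ρ x) ∂μ)
    (e := fun m => c i * ∫ x, |v x - ρ x * h m x| ∂μ) (fun m => ?_) (fun m n => ?_) (fun m => ?_)
    (by simpa using hvh.const_mul (c i))
  · have h1 : ∀ x, ρ x * h m x * (y x / ρ x) = y x * h m x := fun x => by
      have := (hρ0 x).ne'
      field_simp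
    have h2 : ∀ n x, ρ x * h m x * f i (φ n) x = ρ x * f i (φ n) x * h m x := fun n x => by ring
    simp only [h1, h2]
    exact hfy _ (hh m)
  · exact abs_integral_mul_sub_integral_mul_le hv (hρh m) (hfm i _) (hf i _)
  · exact abs_integral_mul_sub_integral_mul_le hv (hρh m) hzm hzc

/-- Bounds on the `L¹` norm pass to weak limits. -/
theorem lintegral_abs_le_of_forall_tendsto [SigmaFinite μ] {f : ℕ → S → ℝ} {z : S → ℝ} {c : ℝ}
    {G : ℝ≥0∞} (hG : G ≠ ∞) (hfm : ∀ n, AEStronglyMeasurable (f n) μ)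
    (hfG : ∀ n, ∫⁻ x, ENNReal.ofReal |f n x| ∂μ ≤ G)
    (hf : ∀ n, ∀ᵐ x ∂μ, |f n x| ≤ c)
    (hzm : AEStronglyMeasurable z μ) (hz : ∀ᵐ x ∂μ, |z x| ≤ c)
    (hfz : ∀ v, Integrable v μ →
      Tendsto (fun n => ∫ x, v x * f n x ∂μ) atTop (𝓝 (∫ x, v x * z x ∂μ))) :
    ∫⁻ x, ENNReal.ofReal |z x| ∂μ ≤ G := by
  have hfi : ∀ n, Integrable (f n) μ := fun n => by
    refine ⟨hfm n, ?_⟩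
    rw [← hasFiniteIntegral_norm_iff,
      hasFiniteIntegral_iff_ofReal (Eventually.of_forall fun _ => norm_nonneg _)]
    exact (hfG n).trans_lt hG.lt_top
  have hfi' : ∀ n, ∫ x, |f n x| ∂μ ≤ G.toReal := fun n => by
    rw [integral_eq_lintegral_of_nonneg_ae (Eventually.of_forall fun _ => abs_nonneg _)
      (hfm n).norm]
    exact ENNReal.toReal_mono hG (hfG n)
  obtain ⟨w, hwm, hzw⟩ := hzm
  have hfin : ∀ A, MeasurableSet A → μ A < ∞ → ∫⁻ x in A, ENNReal.ofReal |z x| ∂μ ≤ G := by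
    intro A hA hμA
    -- The sign of `z`, cut off to `A`, is an `L¹` test function that recovers `∫_A |z|`.
    let s : S → ℝ := fun x => if 0 ≤ w x then 1 else -1
    have hs : Measurable s :=
      Measurable.ite (measurableSet_le measurable_const hwm.measurable) measurable_const
        measurable_const
    have hs1 : ∀ x, |s x| = 1 := fun x => by
      simp only [s]
      split_ifs <;> simp
    have hv : Integrable (A.indicator s) μ := by
      rw [integrable_indicator_iff hA]
      exact (integrableOn_const (C := (1 : ℝ)) hμA.ne).mono' hs.aestronglyMeasurable
        (Eventually.of_forall fun x => (hs1 x).le)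
    have h1 : ∫ x, A.indicator s x * z x ∂μ ≤ G.toReal := by
      refine le_of_tendsto (hfz _ hv) (Eventually.of_forall fun n => ?_)
      refine le_trans ?_ (hfi' n)
      refine integral_mono_ae (hv.mul_of_ae_abs_le (hfm n) (hf n)) (hfi n).abs
        (Eventually.of_forall fun x => ?_)
      refine (le_abs_self _).trans ?_
      rw [abs_mul]
      by_cases hxA : x ∈ A
      · rw [indicator_of_mem hxA, hs1, one_mul]
      · simp [hxA]
    have h2 : ∫ x, A.indicator s x * z x ∂μ = ∫ x in A, |z x| ∂μ := by
      rw [← integral_indicator hA]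
      refine integral_congr_ae ?_
      filter_upwards [hzw] with x hx
      by_cases hxA : x ∈ A
      · simp only [indicator_of_mem hxA, s, hx]
        split_ifs with h0
        · rw [one_mul, abs_of_nonneg h0]
        · rw [abs_of_neg (not_le.1 h0), neg_one_mul]
      · simp [hxA]
    have hzi : IntegrableOn (fun x => |z x|) A μ :=
      (integrableOn_const (C := c) hμA.ne).mono'
        ((hwm.aestronglyMeasurable.congr hzw.symm).norm.restrict)
        (ae_restrict_of_ae (by simpa using hz))
    rw [← ofReal_integral_eq_lintegral_ofReal hzi (Eventually.of_forall fun _ => abs_nonneg _),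
      ← h2]
    exact ENNReal.ofReal_le_of_le_toReal h1
  exact lintegral_le_of_forall_fin_meas_le G fun A hA hμA => hfin A hA hμA.lt_top

end

/-! ### Truncation and weak compactness in `L₀`. -/

/-- Truncation of a real number at the levels `±k`. -/
def clamp (k r : ℝ) : ℝ := max (-k) (min r k)

theorem continuous_clamp (k : ℝ) : Continuous (clamp k) :=
  continuous_const.max (continuous_id.min continuous_const)

theorem abs_clamp_le {k : ℝ} (hk : 0 ≤ k) (r : ℝ) : |clamp k r| ≤ k := by
  rw [clamp, abs_le]
  grind

theorem abs_sub_clamp_le {k : ℝ} (hk : 0 ≤ k) (r : ℝ) : |r - clamp k r| ≤ max (|r| - k) 0 := by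
  rw [clamp, abs_le]
  grind

theorem abs_clamp_sub_clamp_le {k l : ℝ} (hk : 0 ≤ k) (hkl : k ≤ l) (r : ℝ) :
    |clamp l r - clamp k r| ≤ max (|r| - k) 0 := by
  rw [clamp, clamp, abs_le]
  grind

theorem max_abs_sub_le_abs_sub {a b k : ℝ} (hb : |b| ≤ k) : max (|a| - k) 0 ≤ |a - b| := by
  refine max_le ?_ (abs_nonneg _)
  linarith [abs_sub_abs_le_abs_sub a b]

section

variable {S : Type*} [MeasurableSpace S] {μ : Measure S}

theorem abs_integral_mul_sub_integral_mul_le_of_lintegral_le {v a b : S → ℝ} {B : ℝ} {G : ℝ≥0∞}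
    (hB : 0 ≤ B) (hv : ∀ᵐ x ∂μ, |v x| ≤ B) (ha : Integrable (fun x => v x * a x) μ)
    (hb : Integrable (fun x => v x * b x) μ) (ham : AEStronglyMeasurable a μ)
    (hbm : AEStronglyMeasurable b μ) (hG : G ≠ ∞)
    (hab : ∫⁻ x, ENNReal.ofReal |a x - b x| ∂μ ≤ G) :
    |∫ x, v x * a x ∂μ - ∫ x, v x * b x ∂μ| ≤ B * G.toReal := by
  have hi : Integrable (fun x => |a x - b x|) μ := by
    refine ⟨(ham.sub hbm).norm, ?_⟩
    rw [hasFiniteIntegral_iff_ofReal (Eventually.of_forall fun _ => abs_nonneg _)]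
    exact hab.trans_lt hG.lt_top
  calc |∫ x, v x * a x ∂μ - ∫ x, v x * b x ∂μ| ≤ B * ∫ x, |a x - b x| ∂μ := by
        rw [← integral_sub ha hb, ← integral_const_mul, ← Real.norm_eq_abs]
        refine norm_integral_le_of_norm_le (hi.const_mul B) ?_
        filter_upwards [hv] with x hx
        rw [← mul_sub, norm_mul]
        exact mul_le_mul_of_nonneg_right hx (abs_nonneg _)
    _ ≤ B * G.toReal := by
        refine mul_le_mul_of_nonneg_left ?_ hB
        rw [integral_eq_lintegral_of_nonneg_ae (Eventually.of_forall fun _ => abs_nonneg _) hi.1]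
        exact ENNReal.toReal_mono hG hab

/-- A sequence which is Cauchy for the `L¹` distance converges for it, even if its members
are not integrable. -/
theorem exists_lintegral_abs_sub_le_of_cauchy {Z : ℕ → S → ℝ} {G : ℕ → ℝ≥0∞}
    (hZm : ∀ m, AEStronglyMeasurable (Z m) μ) (hG0 : G 0 ≠ ∞) (hG : Tendsto G atTop (𝓝 0))
    (hZ : ∀ m n, m ≤ n → ∫⁻ x, ENNReal.ofReal |Z n x - Z m x| ∂μ ≤ G m) :
    ∃ z : S → ℝ, AEStronglyMeasurable z μ ∧
      ∀ m, ∫⁻ x, ENNReal.ofReal |z x - Z m x| ∂μ ≤ G m := by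
  -- Subtracting the common term `Z 0` moves the sequence into `L¹`, where completeness applies.
  have hi : ∀ m, Integrable (fun x => Z m x - Z 0 x) μ := fun m => by
    refine ⟨(hZm m).sub (hZm 0), ?_⟩
    rw [← hasFiniteIntegral_norm_iff,
      hasFiniteIntegral_iff_ofReal (Eventually.of_forall fun _ => norm_nonneg _)]
    exact (hZ 0 m m.zero_le).trans_lt hG0.lt_top
  have hd : ∀ m n, m ≤ n → edist ((hi n).toL1 _) ((hi m).toL1 _) ≤ G m := fun m n hmn => by
    rw [Integrable.edist_toL1_toL1]
    refine le_trans (le_of_eq (lintegral_congr fun x => ?_)) (hZ m n hmn)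
    rw [edist_dist, Real.dist_eq, sub_sub_sub_cancel_right]
  have hc : CauchySeq fun m => (hi m).toL1 _ := by
    rw [EMetric.cauchySeq_iff']
    intro ε hε
    obtain ⟨N, hN⟩ := (hG.eventually (gt_mem_nhds hε)).exists
    exact ⟨N, fun n hn => (hd N n hn).trans_lt hN⟩
  obtain ⟨f, hf⟩ := cauchySeq_tendsto_of_complete hc
  have hfi : Integrable f μ := L1.integrable_coeFn f
  refine ⟨fun x => f x + Z 0 x, hfi.1.add (hZm 0), fun m => ?_⟩
  have h1 : edist f ((hi m).toL1 _) ≤ G m :=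
    le_of_tendsto (hf.edist tendsto_const_nhds)
      ((eventually_ge_atTop m).mono fun n hn => hd m n hn)
  rw [← Integrable.toL1_coeFn f hfi, Integrable.edist_toL1_toL1] at h1
  refine le_trans (le_of_eq (lintegral_congr fun x => ?_)) h1
  rw [edist_dist, Real.dist_eq]
  congr 2
  ring

/-- A sequence with uniformly controlled excesses `∫ [|w n| - k]⁺ dμ` has a weakly convergent
subsequence. -/
theorem exists_weakTendstoL₀_of_excess_le [SigmaFinite μ] {w : ℕ → S →ₘ[μ] ℝ} {G : ℝ → ℝ≥0∞}
    (hG : ∀ k, 0 < k → G k ≠ ∞) (hG0 : Tendsto G atTop (𝓝 0))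
    (hw : ∀ n k, 0 < k → ∫⁻ x, ENNReal.ofReal (max (|w n x| - k) 0) ∂μ ≤ G k) :
    ∃ z ∈ L₀ μ, ∃ φ : ℕ → ℕ, StrictMono φ ∧ WeakTendstoL₀ (w ∘ φ) z := by
  have hwL : ∀ n, w n ∈ L₀ μ := fun n k hk => (hw n k hk).trans_lt (hG k hk).lt_top
  have hwm : ∀ k n, AEStronglyMeasurable (fun x => clamp k (w n x)) μ := fun k n =>
    (continuous_clamp k).comp_aestronglyMeasurable (w n).aestronglyMeasurable
  have hpos : ∀ q : {q : ℚ // 0 < q}, (0 : ℝ) < q.1 := fun q => by exact_mod_cast q.2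
  -- Rational levels are countable, so one subsequence serves all truncations.
  obtain ⟨φ, hφ, hz⟩ := exists_strictMono_forall_tendsto_integral_mul (μ := μ)
    (fun (q : {q : ℚ // 0 < q}) n x => clamp q.1 (w n x)) (fun q => (q.1 : ℝ))
    (fun q n => hwm q.1 n)
    (fun q n => Eventually.of_forall fun x => abs_clamp_le (hpos q).le _)
  choose z hzm hzb hzt using hz
  -- Truncations of `w n` at levels `p ≤ q` differ by at most `[|w n| - p]⁺`, and this `L¹` bound
  -- survives the weak limit.
  have hd : ∀ p q : {q : ℚ // 0 < q}, p ≤ q →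
      ∫⁻ x, ENNReal.ofReal |z q x - z p x| ∂μ ≤ G p.1 := by
    intro p q hpq
    have hpq' : (p.1 : ℝ) ≤ q.1 := by exact_mod_cast hpq
    refine lintegral_abs_le_of_forall_tendsto (c := (q.1 : ℝ) + p.1) (hG _ (hpos p))
      (f := fun n x => clamp q.1 (w (φ n) x) - clamp p.1 (w (φ n) x))
      (fun n => (hwm _ _).sub (hwm _ _)) (fun n => ?_) (fun n => Eventually.of_forall fun x => ?_)
      ((hzm q).sub (hzm p)) ?_ (fun v hv => ?_)
    · refine (lintegral_mono fun x => ENNReal.ofReal_le_ofReal ?_).trans (hw (φ n) p.1 (hpos p))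
      exact abs_clamp_sub_clamp_le (hpos p).le hpq' _
    · exact (abs_sub _ _).trans
        (add_le_add (abs_clamp_le (hpos q).le _) (abs_clamp_le (hpos p).le _))
    · filter_upwards [hzb p, hzb q] with x h1 h2
      exact (abs_sub _ _).trans (add_le_add h2 h1)
    · have h1 := (hzt q v hv).sub (hzt p v hv)
      rw [← integral_sub (hv.mul_of_ae_abs_le (hzm q) (hzb q))
        (hv.mul_of_ae_abs_le (hzm p) (hzb p))] at h1
      simp only [mul_sub]
      refine h1.congr fun n => (integral_sub ?_ ?_).symm
      · exact hv.mul_of_ae_abs_le (hwm _ _)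
          (Eventually.of_forall fun x => abs_clamp_le (hpos q).le _)
      · exact hv.mul_of_ae_abs_le (hwm _ _)
          (Eventually.of_forall fun x => abs_clamp_le (hpos p).le _)
  -- Levels start at `1`, since `G` is only known to be finite at positive levels.
  let N : ℕ → {q : ℚ // 0 < q} := fun m => ⟨m + 1, by positivity⟩
  have hN : ∀ m, ((N m).1 : ℝ) = m + 1 := fun m => by simp [N]
  have hGN : Tendsto (fun m => G (N m).1) atTop (𝓝 0) := by
    simp only [hN]
    exact hG0.comp (tendsto_atTop_add_const_right _ _ tendsto_natCast_atTop_atTop)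
  obtain ⟨y, hym, hy⟩ := exists_lintegral_abs_sub_le_of_cauchy (Z := fun m => z (N m))
    (fun m => hzm _) (hG _ (hpos _)) hGN
    (fun m n hmn => hd _ _ (Subtype.mk_le_mk.2 (by gcongr)))
  have hyL : AEEqFun.mk y hym ∈ L₀ μ := by
    intro k hk
    obtain ⟨q, hq0, hqk⟩ := exists_rat_btwn hk
    let p : {q : ℚ // 0 < q} := ⟨q, by exact_mod_cast hq0⟩
    obtain ⟨m, hm⟩ := exists_nat_ge q
    -- As `|z p| ≤ p < k`, the excess of `y` over `k` is at most `|y - z p|`, split through `z (N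
    -- m)`.
    have hpm : p ≤ N m := Subtype.mk_le_mk.2 (by linarith)
    calc ∫⁻ x, ENNReal.ofReal (max (|AEEqFun.mk y hym x| - k) 0) ∂μ
        ≤ ∫⁻ x, (ENNReal.ofReal |y x - z (N m) x| + ENNReal.ofReal |z (N m) x - z p x|) ∂μ := by
          refine lintegral_mono_ae ?_
          filter_upwards [AEEqFun.coeFn_mk y hym, hzb p] with x h1 h2
          rw [h1, ← ENNReal.ofReal_add (abs_nonneg _) (abs_nonneg _)]
          exact ENNReal.ofReal_le_ofReal
            ((max_abs_sub_le_abs_sub (h2.trans hqk.le)).trans (abs_sub_le _ _ _))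
      _ = ∫⁻ x, ENNReal.ofReal |y x - z (N m) x| ∂μ
          + ∫⁻ x, ENNReal.ofReal |z (N m) x - z p x| ∂μ :=
          lintegral_add_left' (hym.sub (hzm _)).norm.aemeasurable.ennreal_ofReal _
      _ ≤ G (N m).1 + G p.1 := add_le_add (hy m) (hd p (N m) hpm)
      _ < ∞ := ENNReal.add_lt_top.2 ⟨(hG _ (hpos _)).lt_top, (hG _ (hpos _)).lt_top⟩
  refine ⟨AEEqFun.mk y hym, hyL, φ, hφ, fun v hv => ?_⟩
  have hvi : Integrable v μ := memLp_one_iff_integrable.1 hv.1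
  have hvb : ∀ᵐ x ∂μ, |v x| ≤ (eLpNorm v ∞ μ).toReal := by
    filter_upwards [ae_le_eLpNormEssSup (f := v) (μ := μ)] with x hx
    rw [← eLpNorm_exponent_top] at hx
    simpa using ENNReal.toReal_mono hv.2.2.ne hx
  -- Truncating at level `N m` changes the pairing with `v` by at most `‖v‖_∞ G (N m)`, uniformly in
  -- `n` and also for the limit.
  refine tendsto_of_forall_abs_sub_le
    (a := fun m n => ∫ x, v x * clamp (N m).1 (w (φ n) x) ∂μ)
    (b := fun m => ∫ x, v x * z (N m) x ∂μ)
    (e := fun m => (eLpNorm v ∞ μ).toReal * (G (N m).1).toReal)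
    (fun m => hzt _ v hvi) (fun m n => ?_) (fun m => ?_) ?_
  · refine abs_integral_mul_sub_integral_mul_le_of_lintegral_le ENNReal.toReal_nonneg hvb
      (integrable_mul_of_mem_L₀ (hwL _) hv) (hvi.mul_of_ae_abs_le (hwm _ _)
        (Eventually.of_forall fun x => abs_clamp_le (hpos _).le _))
      (w (φ n)).aestronglyMeasurable (hwm _ _) (hG _ (hpos _))
      ((lintegral_mono fun x => ENNReal.ofReal_le_ofReal ?_).trans (hw (φ n) _ (hpos (N m))))
    exact abs_sub_clamp_le (hpos _).le _
  · refine abs_integral_mul_sub_integral_mul_le_of_lintegral_le ENNReal.toReal_nonneg hvb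
      (integrable_mul_of_mem_L₀ hyL hv) (hvi.mul_of_ae_abs_le (hzm _) (hzb _))
      (AEEqFun.aestronglyMeasurable _) (hzm _) (hG _ (hpos _)) ?_
    refine le_trans (le_of_eq (lintegral_congr_ae ?_)) (hy m)
    filter_upwards [AEEqFun.coeFn_mk y hym] with x h1
    rw [h1]
  · simpa using ((ENNReal.tendsto_toReal ENNReal.zero_ne_top).comp hGN).const_mul
      (eLpNorm v ∞ μ).toReal

end

/-! ### Excesses under `≪`, scaling and differences. -/

/-- These are the only members of `J₀` through which the relation `≪` enters the proof. -/
theorem ofReal_max_abs_sub_mem_J₀ {k : ℝ} (hk : 0 ≤ k) :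
    (fun r : ℝ => ENNReal.ofReal (max (|r| - k) 0)) ∈ J₀ := by
  refine ⟨⟨convex_univ, fun x _ y _ a b _ _ hab => ?_⟩, ?_, by simp [hk]⟩
  · have hab' : (a : ℝ) + b = 1 := by exact_mod_cast hab
    have ha : (0 : ℝ) ≤ a := a.2
    have hb : (0 : ℝ) ≤ b := b.2
    simp only [NNReal.smul_def, smul_eq_mul, ENNReal.smul_def]
    rw [← ENNReal.ofReal_coe_nnreal, ← ENNReal.ofReal_coe_nnreal, ← ENNReal.ofReal_mul ha,
      ← ENNReal.ofReal_mul hb, ← ENNReal.ofReal_add (by positivity) (by positivity)]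
    refine ENNReal.ofReal_le_ofReal (max_le ?_ (by positivity))
    have h1 : |(a : ℝ) * x + b * y| ≤ a * |x| + b * |y| := by
      refine (abs_add_le _ _).trans (le_of_eq ?_)
      rw [abs_mul, abs_mul, abs_of_nonneg ha, abs_of_nonneg hb]
    have h2 := mul_le_mul_of_nonneg_left (le_max_left (|x| - k) 0) ha
    have h3 := mul_le_mul_of_nonneg_left (le_max_left (|y| - k) 0) hb
    have h4 : (a : ℝ) * k + b * k = k := by rw [← add_mul, hab', one_mul]
    linarith
  · exact (ENNReal.continuous_ofReal.comp
      ((continuous_abs.sub continuous_const).max continuous_const)).lowerSemicontinuous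

section

variable {S : Type*} [MeasurableSpace S] {μ : Measure S}

/-- The excess `∫ [|u| - k]⁺ dμ` of `u` over the level `k`. -/
noncomputable def excess (u : S →ₘ[μ] ℝ) (k : ℝ) : ℝ≥0∞ :=
  ∫⁻ x, ENNReal.ofReal (max (|u x| - k) 0) ∂μ

theorem CDom.excess_le {u v : S →ₘ[μ] ℝ} (h : CDom u v) {k : ℝ} (hk : 0 ≤ k) :
    excess u k ≤ excess v k :=
  h _ (ofReal_max_abs_sub_mem_J₀ hk)

theorem excess_smul (c : ℝ) (u : S →ₘ[μ] ℝ) (k : ℝ) :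
    excess (c • u) (|c| * k) = ENNReal.ofReal |c| * excess u k := by
  rw [excess, excess, ← lintegral_const_mul' _ _ ENNReal.ofReal_ne_top]
  refine lintegral_congr_ae ?_
  filter_upwards [AEEqFun.coeFn_smul c u] with x hx
  rw [hx, ← ENNReal.ofReal_mul (abs_nonneg c), Pi.smul_apply, smul_eq_mul, abs_mul, ← mul_sub,
    mul_max_of_nonneg _ _ (abs_nonneg c), mul_zero]

/-- Compare at level `|c| k`: by homogeneity of the excess both sides acquire the same factor `|c|`,
which cancels. -/
theorem CDom.excess_inv_smul_le {u v : S →ₘ[μ] ℝ} {c : ℝ} (hc : c ≠ 0) (h : CDom u (c • v))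
    {k : ℝ} (hk : 0 ≤ k) : excess (c⁻¹ • u) k ≤ excess v k := by
  have h1 := h.excess_le (mul_nonneg (abs_nonneg c) hk)
  rw [excess_smul, ← smul_inv_smul₀ hc u, excess_smul] at h1
  exact (ENNReal.mul_le_mul_iff_right (by simpa using hc) ENNReal.ofReal_ne_top).1 h1

/-- From `|c (v - w)| ≤ K (|v| + |w|)`, the level `k` is shared equally between `v` and `w`, which
leaves `k / (2 * K)` for each. -/
theorem excess_smul_sub_le {c K k : ℝ} (hK : 0 < K) (hc : |c| ≤ K) {u v w : S →ₘ[μ] ℝ}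
    (hv : excess v (k / (2 * K)) ≤ excess u (k / (2 * K)))
    (hw : excess w (k / (2 * K)) ≤ excess u (k / (2 * K))) :
    excess (c • (v - w)) k ≤ ENNReal.ofReal (2 * K) * excess u (k / (2 * K)) := by
  calc excess (c • (v - w)) k
      ≤ ∫⁻ x, ENNReal.ofReal K * (ENNReal.ofReal (max (|v x| - k / (2 * K)) 0)
          + ENNReal.ofReal (max (|w x| - k / (2 * K)) 0)) ∂μ := by
        refine lintegral_mono_ae ?_
        filter_upwards [AEEqFun.coeFn_smul c (v - w), AEEqFun.coeFn_sub v w] with x h1 h2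
        rw [h1, Pi.smul_apply, h2, Pi.sub_apply, smul_eq_mul, abs_mul,
          ← ENNReal.ofReal_add (le_max_right _ _) (le_max_right _ _), ← ENNReal.ofReal_mul hK.le]
        refine ENNReal.ofReal_le_ofReal (max_le ?_ (by positivity))
        have h3 : |c| * |v x - w x| ≤ K * (|v x| + |w x|) :=
          mul_le_mul hc (abs_sub _ _) (abs_nonneg _) hK.le
        have h4 := mul_le_mul_of_nonneg_left (add_le_add (le_max_left (|v x| - k / (2 * K)) 0)
          (le_max_left (|w x| - k / (2 * K)) 0)) hK.le
        have h5 : K * ((|v x| - k / (2 * K)) + (|w x| - k / (2 * K)))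
            = K * (|v x| + |w x|) - k := by
          field_simp
          ring
        linarith
    _ = ENNReal.ofReal K * (excess v (k / (2 * K)) + excess w (k / (2 * K))) := by
        rw [lintegral_const_mul' _ _ ENNReal.ofReal_ne_top, lintegral_add_left', excess, excess]
        exact ((v.aestronglyMeasurable.norm.aemeasurable.sub aemeasurable_const).max
          aemeasurable_const).ennreal_ofReal
    _ ≤ ENNReal.ofReal K * (excess u (k / (2 * K)) + excess u (k / (2 * K))) := by gcongr
    _ = ENNReal.ofReal (2 * K) * excess u (k / (2 * K)) := by
        rw [← two_mul, ← mul_assoc, mul_comm (ENNReal.ofReal K), ENNReal.ofReal_mul zero_le_two,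
          ENNReal.ofReal_ofNat]

theorem tendsto_excess_atTop {u : S →ₘ[μ] ℝ} (hu : u ∈ L₀ μ) :
    Tendsto (excess u) atTop (𝓝 0) := by
  rw [← lintegral_zero (μ := μ)]
  refine tendsto_lintegral_filter_of_dominated_convergence
    (fun x => ENNReal.ofReal (max (|u x| - 1) 0)) (Eventually.of_forall fun k => ?_) ?_
    (hu 1 one_pos).ne (Eventually.of_forall fun x => ?_)
  · exact ((AEEqFun.measurable u).norm.sub_const k |>.max measurable_const).ennreal_ofReal
  · filter_upwards [eventually_ge_atTop (1 : ℝ)] with k hk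
    refine Eventually.of_forall fun x => ENNReal.ofReal_le_ofReal ?_
    gcongr
  · refine tendsto_const_nhds.congr' ?_
    filter_upwards [eventually_ge_atTop |u x|] with k hk
    rw [max_eq_right (by linarith), ENNReal.ofReal_zero]

/-- Multiples `c (v - w)` with bounded `c` and with the excesses of `v` and `w` controlled by
those of an element of `L₀` form a weakly sequentially compact set. -/
theorem isWeaklySeqCompactInL₀_of_excess_le [SigmaFinite μ] {A : Set (S →ₘ[μ] ℝ)}
    {u : S →ₘ[μ] ℝ} (hu : u ∈ L₀ μ) {K : ℝ} (hK : 0 < K)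
    (hA : ∀ q ∈ A, ∃ (c : ℝ) (v w : S →ₘ[μ] ℝ), |c| ≤ K ∧
      (∀ k, 0 ≤ k → excess v k ≤ excess u k) ∧ (∀ k, 0 ≤ k → excess w k ≤ excess u k) ∧
      q = c • (v - w)) :
    IsWeaklySeqCompactInL₀ A := by
  have h1 : ∀ q ∈ A, ∀ k, 0 < k →
      excess q k ≤ ENNReal.ofReal (2 * K) * excess u (k / (2 * K)) := by
    intro q hq k hk
    obtain ⟨c, v, w, hc, hv, hw, rfl⟩ := hA q hq
    have hk' : 0 ≤ k / (2 * K) := by positivity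
    exact excess_smul_sub_le hK hc (hv _ hk') (hw _ hk')
  have h2 : ∀ k, 0 < k → ENNReal.ofReal (2 * K) * excess u (k / (2 * K)) ≠ ∞ := fun k hk =>
    ENNReal.mul_ne_top ENNReal.ofReal_ne_top (hu _ (by positivity)).ne
  have h3 : Tendsto (fun k => ENNReal.ofReal (2 * K) * excess u (k / (2 * K))) atTop (𝓝 0) := by
    have := ENNReal.Tendsto.const_mul ((tendsto_excess_atTop hu).comp
      (tendsto_id.atTop_div_const (show 0 < 2 * K by positivity)))
      (Or.inr (ENNReal.ofReal_ne_top (r := 2 * K)))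
    simpa using this
  refine ⟨fun q hq k hk => (h1 q hq k hk).trans_lt (h2 k hk).lt_top, fun q hq => ?_⟩
  exact exists_weakTendstoL₀_of_excess_le h2 h3 fun n => h1 _ (hq n)

end

/-! ### The difference quotients. -/

/-- The power is `C¹` on a compact interval away from `0`, hence Lipschitz there. The interval is
where `(t + h) / t` lies when `|h| ≤ t / 2`. -/
theorem exists_abs_one_sub_inv_rpow_le (β : ℝ) :
    ∃ D : ℝ, 0 ≤ D ∧ ∀ l ∈ Icc (1 / 2 : ℝ) (3 / 2), |1 - (l ^ β)⁻¹| ≤ D * |l - 1| := by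
  have hd : ContDiffOn ℝ 1 (fun l : ℝ => (l ^ β)⁻¹) (Icc (1 / 2) (3 / 2)) := by
    intro l hl
    have h0 : 0 < l := by linarith [hl.1]
    exact ((contDiffAt_id.rpow_const_of_ne h0.ne').inv
      (Real.rpow_pos_of_pos h0 β).ne').contDiffWithinAt
  obtain ⟨K, hK⟩ := hd.exists_lipschitzOnWith one_ne_zero (convex_Icc _ _) isCompact_Icc
  refine ⟨K, K.2, fun l hl => ?_⟩
  have h1 := hK.dist_le_mul 1 (by norm_num) l hl
  rw [Real.dist_eq, Real.dist_eq, Real.one_rpow, inv_one, abs_sub_comm 1 l] at h1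
  exact h1

theorem lemma4 {S : Type*} [MeasurableSpace S] (μ : Measure S) [SigmaFinite μ]
    (X : BanachSubspace μ) (hXL₀ : (X.space : Set (S →ₘ[μ] ℝ)) ⊆ L₀ μ)
    (hXnormal : X.IsNormal) (hXconv : X.DominatedConvergence)
    (ω α : ℝ) (hα : α ≠ 1)
    (C : Set (S →ₘ[μ] ℝ)) (hCX : C ⊆ (X.space : Set (S →ₘ[μ] ℝ)))
    (T : ℝ → (S →ₘ[μ] ℝ) → (S →ₘ[μ] ℝ))
    (hTC : ∀ t : ℝ, 0 ≤ t → MapsTo (T t) C C)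
    (hTcontr : ∀ t : ℝ, 0 ≤ t → IsQuasiCompleteContractionOn ω (T t) C)
    (hThom : ∀ l : ℝ, 0 < l → ∀ t : ℝ, 0 ≤ t → ∀ u ∈ C,
      l ^ (1 / (α - 1)) • u ∈ C ∧
        l ^ (1 / (α - 1)) • T (l * t) u = T t (l ^ (1 / (α - 1)) • u))
    (h0C : (0 : S →ₘ[μ] ℝ) ∈ C) (hT0 : ∀ t : ℝ, 0 ≤ t → T t 0 = 0)
    (u₀ : S →ₘ[μ] ℝ) (hu₀ : u₀ ∈ C) (t : ℝ) (ht : 0 < t) :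
    IsWeaklySeqCompactInL₀
      {q : S →ₘ[μ] ℝ | ∃ h : ℝ, h ≠ 0 ∧ 0 < t + h ∧ q = h⁻¹ • (T (t + h) u₀ - T t u₀)} := by
  obtain ⟨s, -, hF⟩ := hTcontr t ht.le
  have hL : 0 < Real.exp (ω * s) := Real.exp_pos _
  set L := Real.exp (ω * s)
  set β := 1 / (α - 1)
  obtain ⟨D, hD0, hD⟩ := exists_abs_one_sub_inv_rpow_le β
  have hb : ∀ k, 0 ≤ k → excess (L⁻¹ • T t u₀) k ≤ excess u₀ k := fun k hk => by
    have := (hF u₀ hu₀ 0 h0C).excess_le hk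
    rwa [hT0 t ht.le, smul_zero, sub_zero, sub_zero] at this
  -- `K` adds the coefficient bounds for `|h| ≥ t / 2` and for `|h| < t / 2`.
  refine isWeaklySeqCompactInL₀_of_excess_le (hXL₀ (hCX hu₀))
    (K := 2 * L / t + L * D / t) (by positivity) ?_
  rintro q ⟨h, hh, hth, rfl⟩
  have hl : 0 < (t + h) / t := by positivity
  obtain ⟨hPC, hP⟩ := hThom _ hl t ht.le u₀ hu₀
  have hP0 : 0 < ((t + h) / t) ^ β := Real.rpow_pos_of_pos hl _
  have hDl := hD ((t + h) / t)
  rw [div_mul_cancel₀ _ ht.ne'] at hP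
  generalize ((t + h) / t) ^ β = P at hPC hP hP0 hDl
  by_cases hht : t / 2 ≤ |h|
  · refine ⟨L / h, L⁻¹ • T (t + h) u₀, L⁻¹ • T t u₀, ?_, fun k hk => ?_, hb, ?_⟩
    · have h1 : |L / h| ≤ 2 * L / t := by
        rw [abs_div, abs_of_pos hL, div_le_div_iff₀ (abs_pos.2 hh) ht]
        nlinarith
      have : 0 ≤ L * D / t := by positivity
      linarith
    -- Although `hF` concerns time `t` only, homogeneity transfers it to time `t + h`: it gives `L⁻¹
    -- • P • T (t + h) u₀ ≪ P • u₀`, and `P` cancels in the excesses.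
    · have h1 := hF _ hPC 0 h0C
      rw [hT0 t ht.le, smul_zero, sub_zero, sub_zero, ← hP] at h1
      have h2 := h1.excess_inv_smul_le hP0.ne' hk
      rwa [smul_comm L⁻¹ P, inv_smul_smul₀ hP0.ne'] at h2
    · rw [← smul_sub, smul_smul]
      congr 1
      field_simp
  · by_cases hP1 : P = 1
    · refine ⟨0, L⁻¹ • T t u₀, L⁻¹ • T t u₀, by simp; positivity, hb, hb, ?_⟩
      rw [hP1, one_smul, one_smul] at hP
      rw [hP, sub_self, smul_zero, zero_smul]
    have hP1' : P - 1 ≠ 0 := sub_ne_zero.2 hP1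
    -- Contractivity bounds `L⁻¹ • (T t (P • u₀) - T t u₀)` by `(P - 1) • u₀`; dividing by `P - 1`
    -- leaves `u₀`. The identity used is `(1 - P⁻¹) (P - 1)⁻¹ = P⁻¹`.
    refine ⟨L * (1 - P⁻¹) / h, (P - 1)⁻¹ • (L⁻¹ • T t (P • u₀) - L⁻¹ • T t u₀), L⁻¹ • T t u₀,
      ?_, fun k hk => ?_, hb, ?_⟩
    · have h1 : |L * (1 - P⁻¹) / h| ≤ L * D / t := by
        have h2 : (t + h) / t - 1 = h / t := by
          field_simp
          ring
        have h3 := abs_lt.1 (not_le.1 hht)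
        have h4 := hDl ⟨by rw [le_div_iff₀ ht]; linarith, by rw [div_le_iff₀ ht]; linarith⟩
        rw [h2, abs_div, abs_of_pos ht] at h4
        rw [abs_div, abs_mul, abs_of_pos hL, div_le_iff₀ (abs_pos.2 hh)]
        calc L * |1 - P⁻¹| ≤ L * (D * (|h| / t)) := by gcongr
          _ = L * D / t * |h| := by ring
      have : 0 ≤ 2 * L / t := by positivity
      linarith
    · have h1 := hF _ hPC u₀ hu₀
      have h2 : P • u₀ - u₀ = (P - 1) • u₀ := by rw [sub_smul, one_smul]
      rw [h2] at h1
      exact h1.excess_inv_smul_le hP1' hk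
    · rw [← hP]
      have h1 : P ≠ 0 := hP0.ne'
      have h2 : L ≠ 0 := hL.ne'
      match_scalars <;> field_simp
      ring
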